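/- Let $A_1,\dots,A_n$ be finite groups, $G_n = A_1 * \cdots * A_n$, and $\mathrm{Out}(G_n) = \mathrm{Aut}(G_n)/\mathrm{Inn}(G_n)$. For distinct $i, j \in \{1,\dots,n\}$ and $w \in A_j$, let $f_{A_i}^w \in \mathrm{Out}(G_n)$ be the class of the automorphism of $G_n$ that sends $a$ to $waw^{-1}$ for $a \in A_i$ and is the identity on $A_k$ for every $k \neq i$. Let $\Gamma_n' \le \mathrm{Out}(G_n)$ be the subgroup generated by all such $f_{A_i}^w$ ($i \neq j$, $w \in A_j$). For distinct $i, j$ and fixed non-identity elements $x_i \in A_i$, $x_j \in A_j$, put $$f^{ij} := \prod_{k \neq i, j} f_{A_k}^{x_i} f_{A_k}^{x_j} \in \Gamma_n',$$ where products are compositions of maps (the factors with different $k$ commute). Let $i_1, i_2, i_3, i_4 \in \{1,\dots,n\}$ be distinct and let $x_{i_r} \in A_{i_r}$ be non-identity elements for $r = 1,2,3,4$. Then the subgroup $\langle f^{i_1 i_2}, f^{i_3 i_4} \rangle$ of $\Gamma_n'$ is isomorphic to $\mathbb{Z} \oplus \mathbb{Z}$ and is quasi-isometrically embedded (undistorted)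 in $\Gamma_n'$. That is, both groups are finitely generated, and for every finite generating set $T$ of the subgroup and every finite generating set $S$ of $\Gamma_n'$ there are constants $K \ge 1$, $C \ge 0$ such that $$\tfrac1K\, d_T(g,h) - C \;\le\; d_S(g,h) \;\le\; K\, d_T(g,h) + C$$ for all $g, h \in \langle f^{i_1 i_2}, f^{i_3 i_4} \rangle$, where $d_T$, $d_S$ are the word metrics (the metrics of the Cayley graphs). -/

import Mathlib

/-- A map `f` between sets with distance functions `dX`, `dY` is a quasi-isometric embedding. -/
def IsQuasiIsometricEmbedding {X Y : Type*} (dX : X → X → ℝ) (dY : Y → Y → ℝ) (f : X → Y) :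
    Prop :=
  ∃ K C : ℝ, 1 ≤ K ∧ 0 ≤ C ∧ ∀ x y : X,
    K⁻¹ * dX x y - C ≤ dY (f x) (f y) ∧ dY (f x) (f y) ≤ K * dX x y + C

/-- The word metric of a group with respect to a generating set `S`: the edge-path distance between
vertices of the Cayley graph. -/
noncomputable def wordDist {G : Type*} [Group G] (S : Set G) (g h : G) : ℝ :=
  ((SimpleGraph.mulCayley S).dist g h : ℝ)

/-- A subgroup `H` of a group `G` is undistorted (quasi-isometrically embedded): both are finitely
generated, and for all finite generating sets `T` of `H` and `S` of `G` the inclusion is a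
quasi-isometric embedding of the Cayley graphs. -/
def IsUndistorted {G : Type*} [Group G] (H : Subgroup G) : Prop :=
  Group.FG G ∧ Group.FG H ∧
    ∀ (S : Set G) (T : Set H), S.Finite → T.Finite →
      Subgroup.closure S = ⊤ → Subgroup.closure T = ⊤ →
        IsQuasiIsometricEmbedding (wordDist T) (wordDist S) (fun h : H => (h : G))

/-- Inner automorphisms form a normal subgroup of the automorphism group. -/
instance innerAut_normal (G : Type*) [Group G] : (MulAut.conj (G := G)).range.Normal where
  conj_mem := by
    rintro _ ⟨g, rfl⟩ φ
    refine ⟨φ g, ?_⟩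
    ext x
    simp [MulAut.conj_apply, MulAut.mul_apply]

/-- The outer automorphism group `Out(G) = Aut(G) / Inn(G)`. -/
abbrev Out (G : Type*) [Group G] : Type _ := MulAut G ⧸ (MulAut.conj (G := G)).range

namespace FreeProd

variable {n : ℕ} (A : Fin n → Type*) [∀ i, Group (A i)]

/-- The endomorphism of the free product `A₁ * ⋯ * Aₙ` that conjugates the factor `A i` by the
element `w` and is the identity on every other factor. -/
def partialConjHom (i : Fin n) (w : Monoid.CoprodI A) : Monoid.CoprodI A →* Monoid.CoprodI A :=
  Monoid.CoprodI.lift fun k =>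
    if k = i then (MulAut.conj w).toMonoidHom.comp Monoid.CoprodI.of else Monoid.CoprodI.of

theorem partialConjHom_of_self (i : Fin n) (w : Monoid.CoprodI A) (a : A i) :
    partialConjHom A i w (Monoid.CoprodI.of a) =
      w * Monoid.CoprodI.of a * w⁻¹ := by
  simp [partialConjHom]

theorem partialConjHom_of_ne {i k : Fin n} (hk : k ≠ i) (w : Monoid.CoprodI A) (a : A k) :
    partialConjHom A i w (Monoid.CoprodI.of a) = Monoid.CoprodI.of a := by
  simp [partialConjHom, hk]

theorem partialConjHom_comp_inv (i j : Fin n) (w : A j) :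
    (partialConjHom A i (Monoid.CoprodI.of w)).comp
      (partialConjHom A i (Monoid.CoprodI.of w⁻¹)) = MonoidHom.id _ := by
  refine Monoid.CoprodI.ext_hom _ _ fun k => MonoidHom.ext fun a => ?_
  by_cases hk : k = i
  · subst hk
    by_cases hj : j = k
    · subst hj
      simp [partialConjHom_of_self, mul_assoc]
    · simp [partialConjHom_of_self, partialConjHom_of_ne A hj, mul_assoc]
  · simp [partialConjHom_of_ne A hk]

/-- The automorphism `F_{A i}^w` of `A₁ * ⋯ * Aₙ`, for `w` in a factor `A j`: it sends `a ∈ A i` to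
`w a w⁻¹` and is the identity on every other factor. -/
def partialConj (i j : Fin n) (w : A j) : MulAut (Monoid.CoprodI A) :=
  MonoidHom.toMulEquiv (partialConjHom A i (Monoid.CoprodI.of w))
    (partialConjHom A i (Monoid.CoprodI.of w⁻¹))
    (by simpa using partialConjHom_comp_inv A i j w⁻¹)
    (partialConjHom_comp_inv A i j w)

/-- The outer automorphism `f_{A i}^w` represented by `F_{A i}^w`. -/
def outPartialConj (i j : Fin n) (w : A j) : Out (Monoid.CoprodI A) :=
  QuotientGroup.mk (partialConj A i j w)

/-- The subgroup `Γₙ'` of `Out(A₁ * ⋯ * Aₙ)` generated by all `f_{A i}^w` with `w` in a factor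
`A j` different from `A i`. -/
def GammaPrime : Subgroup (Out (Monoid.CoprodI A)) :=
  Subgroup.closure {φ | ∃ (i j : Fin n) (w : A j), j ≠ i ∧ φ = outPartialConj A i j w}

/-- The outer automorphism `f^{ij} = ∏_{k ≠ i, j} f_{A k}^{x_i} f_{A k}^{x_j}`, with the factors
taken in increasing order of `k` (factors with different `k` commute). -/
def outTwist (i j : Fin n) (xi : A i) (xj : A j) : Out (Monoid.CoprodI A) :=
  (((List.finRange n).filter fun k => k ≠ i ∧ k ≠ j).map fun k =>
    outPartialConj A k i xi * outPartialConj A k j xj).prod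

theorem outTwist_mem (i j : Fin n) (xi : A i) (xj : A j) :
    outTwist A i j xi xj ∈ GammaPrime A := by
  refine Subgroup.list_prod_mem _ fun φ hφ => ?_
  obtain ⟨k, hk, rfl⟩ := List.mem_map.1 hφ
  have hk' : k ≠ i ∧ k ≠ j := by simpa using (List.mem_filter.1 hk).2
  exact mul_mem (Subgroup.subset_closure ⟨k, i, xi, hk'.1.symm, rfl⟩)
    (Subgroup.subset_closure ⟨k, j, xj, hk'.2.symm, rfl⟩)

/-- The outer automorphism `f^{ij}` as an element of `Γₙ'`. -/
def twist (i j : Fin n) (xi : A i) (xj : A j) : GammaPrime A :=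
  ⟨outTwist A i j xi xj, outTwist_mem A i j xi xj⟩

end FreeProd

/-! The twists commute because their representatives commute up to the inner automorphism given by a
commutator (`commute_outTwist`). What remains is a linear lower bound for the word length of
`f^{i₁i₂} ^ a * f^{i₃i₄} ^ b`, which gives both injectivity of `ℤ × ℤ → Γₙ'` and undistortedness.

Retract the free product onto `B = A i₁ * A i₂ * A i₃`. In three factors, conjugating one factor by
`w ∈ B j` is the same as conjugating the remaining one by `w⁻¹`, up to an inner automorphism and an
automorphism inner on each factor. Choosing one target factor for every `j` yields an action of the
group `B` on itself, `partialConjAction`. Every product of partial conjugations of `B` is then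
(inner) · (action of some `h ∈ B`) · (inner on each factor), and one more partial conjugation
changes `h` by one letter (`HasLength.mul_partialConj`).

The element `h` is unique. An automorphism sending each `B i` to `g i B i (g i)⁻¹` determines three
vertices of the Bass-Serre tree, and the factor of the first letter of `h⁻¹` can be read off from
the directions in which these vertices see each other (`exists_conj_partialConjAction`,
`eq_one_of_partialConjAction_eq`). Hence the length of `h` is a lower bound for word length in
`Γₙ'`.

On `B`, the twist `f^{i₁i₂}` acts as a product of two letters from different factors. Since `A i₄`
is killed, `f^{i₃i₄}` becomes inner up to conjugation in the factor `A i₃`, and so is invisible.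
This gives `2|a| ≤ d`; exchanging the two twists gives `2|b| ≤ d`. -/

namespace FreeProd

open Monoid Monoid.CoprodI

/-! ### Reduced words: first letters, lengths, and directions in the Bass-Serre tree. -/

section Leading

variable {ι : Type*} {M : ι → Type*} [∀ i, Group (M i)]

open Classical in
/-- The leading letter of `x` in the factor `M i`: the first letter of the reduced word of `x` if it
lies in `M i`, and `1` otherwise. -/
noncomputable def lead (i : ι) (x : CoprodI M) : M i :=
  (Word.equivPair i (x • (Word.empty : Word M))).head

open Classical in
/-- The number of letters of the reduced word of `x`. -/
noncomputable def len (x : CoprodI M) : ℕ :=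
  (x • (Word.empty : Word M)).toList.length

theorem lead_of_mul (i : ι) (b : M i) (x : CoprodI M) :
    lead i (of b * x) = b * lead i x := by
  classical
  simp only [lead, mul_smul, Word.equivPair_smul_same]

theorem lead_eq_one_of_ne {i j : ι} (hij : i ≠ j) {x : CoprodI M} (h : lead i x ≠ 1) :
    lead j x = 1 := by
  classical
  by_contra hj
  simp only [lead, Word.equivPair_head] at h hj
  split_ifs at h hj with h1 h2
  · exact hij (h1.2.symm.trans h2.2)
  · exact hj rfl
  all_goals exact h rfl

theorem smul_empty_eq_cons {i : ι} {s : M i} (hs : s ≠ 1) {t : CoprodI M} (ht : lead i t = 1) :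
    ∃ h, open Classical in (of s * t) • (Word.empty : Word M) =
      Word.cons s (t • (Word.empty : Word M)) h hs := by
  classical
  have h : (t • (Word.empty : Word M)).fstIdx ≠ some i := by
    have h1 := (Word.equivPair i (t • (Word.empty : Word M))).fstIdx_ne
    have h2 := Word.equivPair_head_smul_equivPair_tail (i := i) (t • (Word.empty : Word M))
    have h3 : (Word.equivPair i (t • (Word.empty : Word M))).head = 1 := by
      convert ht using 1
      simp only [lead]
    rw [h3, map_one, one_smul] at h2
    rwa [← h2]
  refine ⟨h, ?_⟩
  rw [mul_smul, Word.cons_eq_smul]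

@[elab_as_elim]
theorem lead_induction {motive : CoprodI M → Prop} (x : CoprodI M) (one : motive 1)
    (mul : ∀ (i : ι) (s : M i) (t : CoprodI M), s ≠ 1 → lead i t = 1 → motive t →
      motive (of s * t)) : motive x := by
  classical
  suffices h : ∀ w : Word M, motive w.prod by
    have := h (Word.equiv x)
    rwa [show (Word.equiv x).prod = x from Word.equiv.symm_apply_apply x] at this
  intro w
  induction w using Word.consRecOn with
  | empty => simpa using one
  | cons i m w h1 h2 ih =>
    rw [Word.prod_cons]
    refine mul i m _ h2 ?_ ih
    have : w.prod • (Word.empty : Word M) = w := Word.equiv.apply_symm_apply w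
    simp only [lead]
    rw [show w.prod • (Word.empty : Word M) = w by convert this]
    rw [Word.equivPair_eq_of_fstIdx_ne h1]

theorem len_one : len (1 : CoprodI M) = 0 := by
  simp [len]

theorem len_of_mul_of_lead_eq_one {i : ι} {s : M i} (hs : s ≠ 1) {t : CoprodI M}
    (ht : lead i t = 1) : len (of s * t) = len t + 1 := by
  obtain ⟨h, e⟩ := smul_empty_eq_cons hs ht
  simp only [len]
  rw [e]
  simp

theorem lead_one (i : ι) : lead i (1 : CoprodI M) = 1 := by
  classical
  simp only [lead, one_smul]
  rw [Word.equivPair_eq_of_fstIdx_ne (by simp [Word.fstIdx])]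

theorem exists_eq_of_lead_mul (i : ι) (x : CoprodI M) :
    ∃ t, x = of (lead i x) * t ∧ lead i t = 1 :=
  ⟨of (lead i x)⁻¹ * x, by simp, by rw [lead_of_mul, inv_mul_cancel]⟩

theorem len_of_mul_le {i : ι} (a : M i) (x : CoprodI M) : len (of a * x) ≤ len x + 1 := by
  obtain ⟨t, hx, ht⟩ := exists_eq_of_lead_mul i x
  have key : len t ≤ len x := by
    rw [hx]
    by_cases h : lead i x = 1
    · simp [h]
    · rw [len_of_mul_of_lead_eq_one h ht]
      omega
  have : of a * x = of (a * lead i x) * t := by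
    conv_lhs => rw [hx]
    simp [mul_assoc]
  rw [this]
  by_cases h : a * lead i x = 1
  · rw [h]
    simp only [map_one, one_mul]
    omega
  · rw [len_of_mul_of_lead_eq_one h ht]
    omega

theorem lead_of_mul_of_ne {i m : ι} (him : i ≠ m) {b : M m} {x : CoprodI M}
    (h : b * lead m x ≠ 1) : lead i (of b * x) = 1 :=
  lead_eq_one_of_ne him.symm (by rwa [lead_of_mul])

theorem lead_of_of_ne {i j : ι} (hij : i ≠ j) (a : M j) : lead i (of a : CoprodI M) = 1 := by
  by_cases h : a = 1
  · rw [h, map_one, lead_one]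
  · simpa using lead_of_mul_of_ne hij (b := a) (x := 1) (by simpa [lead_one] using h)

theorem exists_lead_ne_one {x : CoprodI M} (hx : x ≠ 1) : ∃ m, lead m x ≠ 1 := by
  induction x using lead_induction with
  | one => exact absurd rfl hx
  | mul i s t hs ht _ => exact ⟨i, by simpa [lead_of_mul, ht] using hs⟩

/-- Right multiplication by a letter of another factor does not change the leading letter. -/
theorem lead_mul_of_of_ne {j : ι} (a : M j) (x : CoprodI M) :
    ∀ i, i ≠ j → lead i (x * of a) = lead i x := by
  induction x using lead_induction with
  | one =>
    intro i hij
    simp [lead_one, lead_of_of_ne hij]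
  | mul m s t hs ht ih =>
    intro i hij
    -- The new letter can merge with `s` only when `t = 1` and `m = j`; otherwise `s` stays the
    -- first letter.
    have hm : m ≠ j ∨ t ≠ 1 → lead m (t * of a) = 1 := by
      rintro hmt
      by_cases hmj : m = j
      · subst hmj
        obtain ⟨m', hm'⟩ := exists_lead_ne_one (hmt.resolve_left (by simp))
        have hne : m' ≠ m := by
          rintro rfl
          exact hm' ht
        exact lead_eq_one_of_ne hne (by rwa [ih m' hne])
      · rw [ih m hmj, ht]
    by_cases hmt : m ≠ j ∨ t ≠ 1
    · rw [mul_assoc]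
      by_cases him : i = m
      · subst him
        rw [lead_of_mul, lead_of_mul, hm hmt, ht]
      · rw [lead_of_mul_of_ne him (by simpa [hm hmt] using hs),
          lead_of_mul_of_ne him (by simpa [ht] using hs)]
    · push Not at hmt
      obtain ⟨rfl, rfl⟩ := hmt
      rw [mul_one, ← map_mul, lead_of_of_ne hij, lead_of_of_ne hij]

/-- Right multiplication of an element outside of `M j` by a letter of `M j` does not change the
leading letter. -/
theorem lead_mul_of_of_notMem {j : ι} (a : M j) (x : CoprodI M)
    (hx : ∀ c : M j, x ≠ of c) : lead j (x * of a) = lead j x := by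
  induction x using lead_induction with
  | one => exact absurd (map_one _).symm (hx 1)
  | mul m s t hs ht ih =>
    rw [mul_assoc]
    by_cases hmj : j = m
    · subst hmj
      rw [lead_of_mul, lead_of_mul, ih]
      rintro c rfl
      exact hx (s * c) (map_mul _ _ _).symm
    · rw [lead_of_mul_of_ne hmj (by simpa [lead_mul_of_of_ne a t m (Ne.symm hmj), ht] using hs),
        lead_of_mul_of_ne hmj (by simpa [ht] using hs)]

/-- For two vertices of the Bass-Serre tree of a free product and any third one, the third one is
seen from one of the two in the direction of the other. -/
theorem lead_eq_or_lead_eq (x y : CoprodI M) {j : ι} (hx : lead j x ≠ lead j y⁻¹) :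
    ∀ i, i ≠ j → lead i (y * x) = lead i y := by
  induction y using lead_induction with
  | one =>
    intro i hij
    rw [inv_one, lead_one] at hx
    simp [lead_one, lead_eq_one_of_ne hij.symm hx]
  | mul m s t hs ht ih =>
    intro i hij
    rw [mul_inv_rev, ← map_inv] at hx
    -- Either `s` survives as the first letter of `y * x`, or `y` is a single letter of `M j`, and
    -- then `hx` says that it does not cancel the leading letter of `x`.
    suffices h : lead m (t * x) = 1 ∨ (m = j ∧ t = 1) by
      rcases h with h | ⟨rfl, rfl⟩
      · rw [mul_assoc]
        by_cases him : i = m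
        · subst him
          rw [lead_of_mul, lead_of_mul, h, ht]
        · rw [lead_of_mul_of_ne him (by simpa [h] using hs),
            lead_of_mul_of_ne him (by simpa [ht] using hs)]
      · rw [mul_one, lead_of_of_ne hij]
        refine lead_of_mul_of_ne hij fun h => hx ?_
        have := lead_of_mul m s⁻¹ 1
        simp only [mul_one, lead_one] at this
        rw [inv_one, one_mul, this]
        exact (inv_eq_of_mul_eq_one_right h).symm
    by_cases hmj : m = j
    · subst hmj
      by_cases ht1 : t = 1
      · exact Or.inr ⟨rfl, ht1⟩
      · left
        obtain ⟨m', hm'⟩ := exists_lead_ne_one ht1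
        have hne : m' ≠ m := by
          rintro rfl
          exact hm' ht
        refine lead_eq_one_of_ne hne ?_
        rwa [ih _ m' hne]
        rwa [lead_mul_of_of_notMem] at hx
        rintro c hc
        rw [inv_eq_iff_eq_inv, ← map_inv] at hc
        rw [hc] at ht
        have := lead_of_mul m c⁻¹ 1
        simp only [mul_one, lead_one, ht] at this
        rw [← this, map_one] at hc
        exact ht1 hc
    · left
      rw [ih _ m hmj, ht]
      rwa [lead_mul_of_of_ne _ _ _ (Ne.symm hmj)] at hx

/-- The centralizer of a nontrivial element of a free factor lies in this factor. -/
theorem exists_eq_of_of_commute {i : ι} {a : M i} (ha : a ≠ 1) {z : CoprodI M}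
    (h : z * of a = of a * z) : ∃ c : M i, z = of c := by
  by_contra! hz
  have h1 := lead_mul_of_of_notMem a z hz
  rw [h, lead_of_mul] at h1
  exact ha (by simpa using h1)

theorem lead_len_mul_pow {p q : ι} (hpq : p ≠ q) {x : M p} {y : M q} (hx : x ≠ 1) (hy : y ≠ 1)
    (a : ℕ) : len ((of x * of y : CoprodI M) ^ a) = 2 * a ∧
      lead q ((of x * of y : CoprodI M) ^ a) = 1 := by
  induction a with
  | zero => simp [len_one, lead_one]
  | succ a ih =>
    have h1 : lead q (of y * (of x * of y : CoprodI M) ^ a) ≠ 1 := by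
      simpa [lead_of_mul, ih.2] using hy
    have h2 : lead p (of y * (of x * of y : CoprodI M) ^ a) = 1 :=
      lead_eq_one_of_ne hpq.symm h1
    rw [pow_succ', mul_assoc]
    refine ⟨?_, lead_of_mul_of_ne hpq.symm (by simpa [h2] using hx)⟩
    rw [len_of_mul_of_lead_eq_one hx h2, len_of_mul_of_lead_eq_one hy ih.2, ih.1]
    ring

theorem len_mul_zpow {p q : ι} (hpq : p ≠ q) {x : M p} {y : M q} (hx : x ≠ 1) (hy : y ≠ 1)
    (a : ℤ) : len ((of x * of y : CoprodI M) ^ a) = 2 * a.natAbs := by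
  rcases Int.natAbs_eq a with h | h
  · conv_lhs => rw [h, zpow_natCast]
    exact (lead_len_mul_pow hpq hx hy _).1
  · conv_lhs => rw [h, zpow_neg, zpow_natCast, ← inv_pow, mul_inv_rev, ← map_inv, ← map_inv]
    exact (lead_len_mul_pow hpq.symm (inv_ne_one.2 hy) (inv_ne_one.2 hx) _).1

end Leading

/-! ### Partial conjugations and automorphisms that are inner on each factor. -/

section PartialConj

variable {n : ℕ} (A : Fin n → Type*) [∀ i, Group (A i)]

theorem mulAut_ext {φ ψ : MulAut (CoprodI A)} (h : ∀ i (a : A i), φ (of a) = ψ (of a)) :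
    φ = ψ := by
  have : φ.toMonoidHom = ψ.toMonoidHom :=
    CoprodI.ext_hom _ _ fun i => MonoidHom.ext fun a => h i a
  ext x
  exact DFunLike.congr_fun this x

theorem partialConj_of_self {i : Fin n} (j : Fin n) (w : A j) (a : A i) :
    partialConj A i j w (of a) = of w * of a * (of w)⁻¹ :=
  partialConjHom_of_self A i _ a

theorem partialConj_of_ne {i k : Fin n} (hk : k ≠ i) (j : Fin n) (w : A j) (a : A k) :
    partialConj A i j w (of a) = of a :=
  partialConjHom_of_ne A hk _ a

theorem partialConj_inv (i j : Fin n) (w : A j) :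
    (partialConj A i j w)⁻¹ = partialConj A i j w⁻¹ := by
  ext x
  rfl

/-- The order is reversed because the outer map fixes `w' ∈ A j`, so its conjugator lands inside
that of the inner map. -/
theorem partialConj_mul_partialConj {i j : Fin n} (hij : i ≠ j) (w w' : A j) :
    partialConj A i j w * partialConj A i j w' = partialConj A i j (w' * w) := by
  refine mulAut_ext A fun k a => ?_
  rw [MulAut.mul_apply]
  by_cases hk : k = i
  · subst hk
    simp [partialConj_of_self, partialConj_of_ne A hij.symm, mul_assoc]
  · simp [partialConj_of_ne A hk]

theorem partialConj_one (i j : Fin n) : partialConj A i j 1 = 1 := by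
  refine mulAut_ext A fun k a => ?_
  by_cases hk : k = i
  · subst hk
    simp [partialConj_of_self]
  · simp [partialConj_of_ne A hk]

/-- The group of automorphisms that restrict to an inner automorphism of each factor. -/
def factorInner : Subgroup (MulAut (CoprodI A)) :=
  Subgroup.closure {φ | ∃ (j : Fin n) (w : A j), φ = partialConj A j j w}

theorem exists_of_mem_factorInner {ν : MulAut (CoprodI A)} (hν : ν ∈ factorInner A) :
    ∃ c : ∀ j, A j, ∀ j (a : A j), ν (of a) = of (c j * a * (c j)⁻¹) := by
  induction hν using Subgroup.closure_induction with
  | mem φ hφ =>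
    obtain ⟨j, w, rfl⟩ := hφ
    refine ⟨Pi.mulSingle j w, fun k a => ?_⟩
    by_cases hk : k = j
    · subst hk
      simp [partialConj_of_self]
    · simp [partialConj_of_ne A hk, hk]
  | one => exact ⟨1, by simp⟩
  | mul φ ψ _ _ hφ hψ =>
    obtain ⟨c, hc⟩ := hφ
    obtain ⟨d, hd⟩ := hψ
    refine ⟨c * d, fun j a => ?_⟩
    rw [MulAut.mul_apply, hd, hc]
    simp [mul_assoc]
  | inv φ _ hφ =>
    obtain ⟨c, hc⟩ := hφ
    refine ⟨c⁻¹, fun j a => ?_⟩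
    rw [MulAut.inv_apply, MulEquiv.symm_apply_eq, hc]
    simp [mul_assoc]

/-- An automorphism that is conjugation by `c j` on `A j` carries `w` to `c j * w * (c j)⁻¹`. This
lets factorwise inner terms be moved to the right end of a product. -/
theorem factorInner_mul_partialConj {ν : MulAut (CoprodI A)} (hν : ν ∈ factorInner A)
    (i j : Fin n) (w : A j) : ∃ w' : A j, ν * partialConj A i j w = partialConj A i j w' * ν := by
  obtain ⟨c, hc⟩ := exists_of_mem_factorInner A hν
  refine ⟨c j * w * (c j)⁻¹, mulAut_ext A fun k a => ?_⟩
  rw [MulAut.mul_apply, MulAut.mul_apply]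
  by_cases hk : k = i
  · subst hk
    rw [partialConj_of_self, hc k a, partialConj_of_self]
    simp only [map_mul, map_inv, hc]
  · simp only [partialConj_of_ne A hk, hc]

theorem mul_conj {G : Type*} [Group G] (φ : MulAut G) (g : G) :
    φ * MulAut.conj g = MulAut.conj (φ g) * φ := by
  ext x
  simp

end PartialConj

/-! ### Three factors: the action of the free product on itself is faithful modulo inner and
factorwise inner automorphisms. -/

section PingPong

variable (B : Fin 3 → Type*) [∀ i, Group (B i)]

/-- A choice of an index different from the given one. -/
def otherIdx : Fin 3 → Fin 3 := ![2, 2, 0]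

theorem otherIdx_ne (j : Fin 3) : otherIdx j ≠ j := by
  revert j
  decide

theorem eq_otherIdx {m i j : Fin 3} (hi : i ≠ m) (hj : j ≠ m) (hij : i ≠ j) :
    (i = otherIdx m ∧ j ≠ otherIdx m) ∨ (j = otherIdx m ∧ i ≠ otherIdx m) := by
  have : ∀ m i j : Fin 3, (i ≠ m ∧ j ≠ m ∧ i ≠ j) →
      (i = otherIdx m ∧ j ≠ otherIdx m) ∨ (j = otherIdx m ∧ i ≠ otherIdx m) := by decide
  exact this m i j ⟨hi, hj, hij⟩

theorem exists_third (m : Fin 3) : ∃ i, i ≠ m ∧ i ≠ otherIdx m := by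
  revert m
  decide

/-- The action of `A₁ * A₂ * A₃` on itself in which a letter of a factor acts by a partial
conjugation of one other factor. -/
def partialConjAction : CoprodI B →* MulAut (CoprodI B) :=
  lift fun j =>
    -- The inverse compensates for the reversed order in `partialConj_mul_partialConj`.
    { toFun := fun c => partialConj B (otherIdx j) j c⁻¹
      map_one' := by rw [inv_one, partialConj_one]
      map_mul' := fun c d => by
        rw [partialConj_mul_partialConj B (otherIdx_ne j), mul_inv_rev] }

theorem partialConjAction_of {j : Fin 3} (c : B j) :
    partialConjAction B (of c) = partialConj B (otherIdx j) j c⁻¹ := by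
  simp [partialConjAction]

/-- All vertices `g i • B i` of the Bass-Serre tree are seen from `g j • B j` in one direction. -/
def SameDirection (g : Fin 3 → CoprodI B) (j : Fin 3) : Prop :=
  ∀ i, i ≠ j → ∀ l, l ≠ j → lead j ((g j)⁻¹ * g i) = lead j ((g j)⁻¹ * g l)

/-- A ping-pong invariant: for `x ≠ 1`, the first letter of `x` lies in the one factor `j` whose
vertex separates the other two vertices. Prepending a letter of `B m` rotates one vertex around the
vertex of `m`, which then becomes the separating one. -/
theorem exists_conj_partialConjAction (x : CoprodI B) :
    ∃ g : Fin 3 → CoprodI B,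
      (∀ i (a : B i), partialConjAction B x⁻¹ (of a) = g i * of a * (g i)⁻¹) ∧
      ∀ j, lead j x = 1 ↔ SameDirection B g j := by
  induction x using lead_induction with
  | one => exact ⟨1, by simp, by simp [SameDirection, lead_one]⟩
  | mul m s t hs ht ih =>
    obtain ⟨g, hg, hd⟩ := ih
    set k := otherIdx m with hk
    have hkm : k ≠ m := otherIdx_ne m
    -- The letter `s` acts first and conjugates only the factor `k` by `s`; the action of `t⁻¹` then
    -- sends `s` to `g m * s * (g m)⁻¹`.
    refine ⟨Function.update g k (g m * of s * (g m)⁻¹ * g k), ?_, ?_⟩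
    · intro i a
      rw [mul_inv_rev, ← map_inv, map_mul, MulAut.mul_apply, partialConjAction_of, inv_inv,
        ← hk]
      by_cases hi : i = k
      · subst hi
        rw [partialConj_of_self, Function.update_self, map_mul, map_mul,
          map_inv (partialConjAction B t⁻¹) (of s), hg, hg]
        group
      · rw [partialConj_of_ne B hi, hg, Function.update_of_ne hi]
    · set g' := Function.update g k (g m * of s * (g m)⁻¹ * g k) with hg'
      have hm : SameDirection B g m := (hd m).1 ht
      -- Before the rotation the vertex of `m` saw the other two in one direction; now the direction
      -- of `k` is shifted by `s ≠ 1`.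
      have hne : ∀ i, i ≠ m → i ≠ k → lead m ((g' m)⁻¹ * g' i) ≠ lead m ((g' m)⁻¹ * g' k) := by
        intro i him hik
        rw [hg', Function.update_self, Function.update_of_ne hkm.symm, Function.update_of_ne hik,
          show (g m)⁻¹ * (g m * of s * (g m)⁻¹ * g k) = of s * ((g m)⁻¹ * g k) by group,
          lead_of_mul, hm i him k hkm]
        simpa using hs
      intro j
      by_cases hj : j = m
      · subst hj
        rw [lead_of_mul, ht, mul_one]
        refine ⟨fun h => absurd h hs, fun h => ?_⟩
        obtain ⟨i, hij, hik⟩ := exists_third j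
        exact absurd (h i hij k hkm) (hne i hij hik)
      · refine ⟨fun _ => ?_, fun _ => lead_of_mul_of_ne hj (by simpa [ht] using hs)⟩
        -- The vertex of `m` lies between those of `i` and `j`, so from `j` the vertex of `i`
        -- appears in the direction of `m`.
        have key : ∀ i, i ≠ j → lead j ((g' j)⁻¹ * g' i) = lead j ((g' j)⁻¹ * g' m) := by
          intro i hij
          by_cases him : i = m
          · rw [him]
          have hne' : lead m ((g' m)⁻¹ * g' i) ≠ lead m ((g' j)⁻¹ * g' m)⁻¹ := by
            rw [mul_inv_rev, inv_inv]
            rcases eq_otherIdx him hj hij with ⟨h1, h2⟩ | ⟨h1, h2⟩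
            · rw [h1]
              exact (hne j hj h2).symm
            · rw [h1]
              exact hne i him h2
          rw [← lead_eq_or_lead_eq _ _ hne' j hj]
          congr 1
          group
        intro i hi l hl
        rw [key i hi, key l hl]

/-- For such an automorphism the three vertices are a translate of the base ones, none of which
separates the other two, so `x` has no first letter. -/
theorem eq_one_of_partialConjAction_eq (hB : ∀ i, Nontrivial (B i)) {x g₀ : CoprodI B}
    {ν : MulAut (CoprodI B)} (hν : ν ∈ factorInner B)
    (h : partialConjAction B x⁻¹ = MulAut.conj g₀ * ν) : x = 1 := by
  obtain ⟨g, hg, hd⟩ := exists_conj_partialConjAction B x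
  obtain ⟨c, hc⟩ := exists_of_mem_factorInner B hν
  -- Two conjugators with the same effect on `B i` differ by an element centralizing a nontrivial `a
  -- : B i`, hence by an element of `B i`.
  have he : ∀ i, ∃ e : B i, g i = g₀ * of e := by
    intro i
    obtain ⟨a, ha⟩ := exists_ne (1 : B i)
    obtain ⟨d, hd⟩ := exists_eq_of_of_commute ha (z := (of (c i))⁻¹ * g₀⁻¹ * g i) (by
      have := hg i a
      rw [h, MulAut.mul_apply, hc, MulAut.conj_apply] at this
      rw [eq_mul_inv_iff_mul_eq] at this
      simp only [map_mul, map_inv] at this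
      rw [mul_assoc, ← this]
      group)
    refine ⟨c i * d, ?_⟩
    rw [map_mul, ← hd]
    group
  choose e he using he
  by_contra hx
  obtain ⟨j, hj⟩ := exists_lead_ne_one hx
  refine hj ((hd j).2 ?_)
  have key : ∀ i, i ≠ j → lead j ((g j)⁻¹ * g i) = (e j)⁻¹ := by
    intro i hij
    rw [he, he, show (g₀ * of (e j))⁻¹ * (g₀ * of (e i)) = of (e j)⁻¹ * of (e i) by
      rw [map_inv]; group, lead_of_mul, lead_of_of_ne hij.symm, mul_one]
  intro i hi l hl
  rw [key i hi, key l hl]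

end PingPong

/-! ### The length of a product of partial conjugations of three factors. -/

section Normal

variable (B : Fin 3 → Type*) [∀ i, Group (B i)]

/-- The automorphisms that are products of an inner automorphism, the inverse of the action of an
element of length at most `m` and an automorphism that is inner on each factor. -/
def HasLength (m : ℕ) (θ : MulAut (CoprodI B)) : Prop :=
  ∃ (g h : CoprodI B) (ν : MulAut (CoprodI B)), ν ∈ factorInner B ∧ len h⁻¹ ≤ m ∧
    θ = MulAut.conj g * partialConjAction B h * ν

/-- If `i` is not the chosen target of `j`, conjugating `B i` by `w` amounts to conjugating
everything by `w` and undoing this on the other two factors, one of which is `B j` itself. -/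
theorem exists_partialConj_eq {i j : Fin 3} (hij : i ≠ j) (w : B j) :
    ∃ (g : CoprodI B) (a : B j) (ν : MulAut (CoprodI B)), ν ∈ factorInner B ∧
      partialConj B i j w = MulAut.conj g * partialConjAction B (of a) * ν := by
  by_cases hi : i = otherIdx j
  · exact ⟨1, w⁻¹, 1, one_mem _, by simp only [partialConjAction_of, hi, inv_inv, map_one,
      one_mul, mul_one]⟩
  · refine ⟨of w, w, partialConj B j j w⁻¹, Subgroup.subset_closure ⟨j, _, rfl⟩, ?_⟩
    refine mulAut_ext B fun k a => ?_
    have hj := (otherIdx_ne j).symm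
    rw [MulAut.mul_apply, MulAut.mul_apply, partialConjAction_of, MulAut.conj_apply]
    by_cases hkj : k = j
    · subst hkj
      simp [partialConj_of_self, partialConj_of_ne B hij.symm, partialConj_of_ne B hj, mul_assoc]
    · by_cases hki : k = i
      · subst hki
        simp [partialConj_of_self, partialConj_of_ne B hij, partialConj_of_ne B hi]
      · have hk : k = otherIdx j := by
          rcases eq_otherIdx hij hkj (Ne.symm hki) with h | h
          · exact absurd h.1 hi
          · exact h.1
        subst hk
        simp [partialConj_of_self, partialConj_of_ne B hkj, partialConj_of_ne B hki, mul_assoc]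

/-- The new factor is moved past `ν`, and its inner part past the action of `h`, so only one letter
is appended to `h`. Lengths are taken of `h⁻¹`, where this letter is prepended. -/
theorem HasLength.mul_partialConj {m : ℕ} {θ : MulAut (CoprodI B)} (hθ : HasLength B m θ)
    {i j : Fin 3} (hij : i ≠ j) (w : B j) : HasLength B (m + 1) (θ * partialConj B i j w) := by
  obtain ⟨g, h, ν, hν, hm, rfl⟩ := hθ
  obtain ⟨w', hw'⟩ := factorInner_mul_partialConj B hν i j w
  obtain ⟨g₁, a, ν₁, hν₁, h₁⟩ := exists_partialConj_eq B hij w'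
  refine ⟨g * partialConjAction B h g₁, h * of a, ν₁ * ν, mul_mem hν₁ hν, ?_, ?_⟩
  · rw [mul_inv_rev, ← map_inv]
    exact (len_of_mul_le _ _).trans (by omega)
  · rw [mul_assoc, hw', h₁, map_mul, map_mul]
    calc _ = MulAut.conj g * (partialConjAction B h * MulAut.conj g₁) *
          partialConjAction B (of a) * ν₁ * ν := by group
      _ = _ := by
        rw [mul_conj]
        group

theorem HasLength.mono {m m' : ℕ} {θ : MulAut (CoprodI B)} (hθ : HasLength B m θ)
    (h : m ≤ m') : HasLength B m' θ := by
  obtain ⟨g, x, ν, hν, hm, rfl⟩ := hθ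
  exact ⟨g, x, ν, hν, hm.trans h, rfl⟩

/-- Two decompositions of one automorphism have the same `h`: comparing them shows that the action
of `(h⁻¹ * h')⁻¹` is inner times factorwise inner. -/
theorem HasLength.len_le (hB : ∀ i, Nontrivial (B i)) {m : ℕ} {g h : CoprodI B}
    {ν : MulAut (CoprodI B)} (hν : ν ∈ factorInner B)
    (H : HasLength B m (MulAut.conj g * partialConjAction B h * ν)) : len h⁻¹ ≤ m := by
  obtain ⟨g', h', ν', hν', hm, e⟩ := H
  have key : partialConjAction B (h⁻¹ * h')⁻¹ =
      MulAut.conj (partialConjAction B h'⁻¹ (g⁻¹ * g')) * (ν' * ν⁻¹) := by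
    have e' : partialConjAction B h =
        MulAut.conj (g⁻¹ * g') * partialConjAction B h' * (ν' * ν⁻¹) := by
      rw [← mul_assoc, eq_mul_inv_iff_mul_eq, map_mul, map_inv]
      simp only [mul_assoc] at e ⊢
      rw [eq_inv_mul_iff_mul_eq, e]
    rw [mul_inv_rev, inv_inv, map_mul, e', ← mul_assoc, ← mul_assoc (partialConjAction B _),
      mul_conj, mul_assoc (MulAut.conj _), ← map_mul, inv_mul_cancel, map_one, mul_one]
  have := eq_one_of_partialConjAction_eq B hB (mul_mem hν' (inv_mem hν)) key
  rw [inv_mul_eq_one] at this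
  rwa [this]

end Normal

/-! ### Passing from all factors to three of them. -/

section Retract

variable {n : ℕ} (A : Fin n → Type*) [∀ i, Group (A i)] (t : Fin 3 → Fin n)

/-- The identification of factors with equal indices. -/
def castFactor {k l : Fin n} (h : k = l) : A k →* A l :=
  h ▸ MonoidHom.id (A k)

open Classical in
/-- The retraction of a free product onto three of its factors, killing all other factors. -/
noncomputable def retract : CoprodI A →* CoprodI (fun j => A (t j)) :=
  lift fun k =>
    if h : ∃ j, t j = k then
      (of (M := fun j => A (t j)) (i := h.choose)).comp (castFactor A h.choose_spec.symm)
    else 1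

variable {t}

theorem retract_of (ht : Function.Injective t) (j : Fin 3) (a : A (t j)) :
    retract A t (of a) = of (M := fun j => A (t j)) (i := j) a := by
  have key : ∀ (j' : Fin 3) (h : t j = t j'),
      of (M := fun j => A (t j)) (i := j') (castFactor A h a) =
        of (M := fun j => A (t j)) (i := j) a := by
    intro j' h
    obtain rfl := ht h
    rfl
  have h : ∃ j', t j' = t j := ⟨j, rfl⟩
  simp only [retract, lift_of, dif_pos h, MonoidHom.comp_apply]
  exact key _ _

theorem retract_of_of_notMem {k : Fin n} (hk : ∀ j, k ≠ t j) (a : A k) :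
    retract A t (of a) = 1 := by
  have h : ¬ ∃ j, t j = k := fun ⟨j, h⟩ => hk j h.symm
  simp [retract, dif_neg h]

variable (t) in
/-- The automorphism `φ` of the free product induces the automorphism `θ` of the free product of
three of its factors. -/
def Induces (φ : MulAut (CoprodI A)) (θ : MulAut (CoprodI fun j => A (t j))) : Prop :=
  ∀ x, retract A t (φ x) = θ (retract A t x)

variable {A}

theorem induces_of_forall {φ : MulAut (CoprodI A)} {θ : MulAut (CoprodI fun j => A (t j))}
    (h : ∀ k (a : A k), retract A t (φ (of a)) = θ (retract A t (of a))) : Induces A t φ θ := by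
  have : (retract A t).comp φ.toMonoidHom = θ.toMonoidHom.comp (retract A t) :=
    CoprodI.ext_hom _ _ fun i => MonoidHom.ext fun a => h i a
  exact fun x => DFunLike.congr_fun this x

theorem induces_one : Induces A t 1 1 := fun _ => rfl

theorem induces_conj (z : CoprodI A) :
    Induces A t (MulAut.conj z) (MulAut.conj (retract A t z)) := fun x => by simp

theorem Induces.mul {φ φ' : MulAut (CoprodI A)} {θ θ' : MulAut (CoprodI fun j => A (t j))}
    (h : Induces A t φ θ) (h' : Induces A t φ' θ') : Induces A t (φ * φ') (θ * θ') := fun x => by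
  rw [MulAut.mul_apply, MulAut.mul_apply, h, h']

theorem Induces.inv {φ : MulAut (CoprodI A)} {θ : MulAut (CoprodI fun j => A (t j))}
    (h : Induces A t φ θ) : Induces A t φ⁻¹ θ⁻¹ := fun x => by
  rw [MulAut.inv_apply, MulAut.inv_apply, MulEquiv.eq_symm_apply, ← h, MulEquiv.apply_symm_apply]

theorem Induces.pow {φ : MulAut (CoprodI A)} {θ : MulAut (CoprodI fun j => A (t j))}
    (h : Induces A t φ θ) (a : ℕ) : Induces A t (φ ^ a) (θ ^ a) := by
  induction a with
  | zero => simpa using induces_one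
  | succ a ih => simpa only [pow_succ] using ih.mul h

theorem Induces.zpow {φ : MulAut (CoprodI A)} {θ : MulAut (CoprodI fun j => A (t j))}
    (h : Induces A t φ θ) (a : ℤ) : Induces A t (φ ^ a) (θ ^ a) := by
  obtain ⟨b, rfl | rfl⟩ := a.eq_nat_or_neg
  · simpa using h.pow b
  · simpa using (h.pow b).inv

/-- The retraction is onto: it hits every letter of the three factors. -/
theorem Induces.unique (ht : Function.Injective t) {φ : MulAut (CoprodI A)}
    {θ θ' : MulAut (CoprodI fun j => A (t j))} (h : Induces A t φ θ) (h' : Induces A t φ θ') :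
    θ = θ' := by
  refine mulAut_ext _ fun j a => ?_
  rw [← retract_of A ht, ← h, ← h']

/-- Killing either the conjugated factor or the factor of the conjugator leaves the identity. -/
theorem exists_induces_partialConj (ht : Function.Injective t) {i j : Fin n} (hij : i ≠ j)
    (w : A j) : ∃ θ, Induces A t (partialConj A i j w) θ ∧ (θ = 1 ∨
      ∃ (i' j' : Fin 3) (w' : A (t j')), i' ≠ j' ∧
        θ = partialConj (fun j => A (t j)) i' j' w') := by
  by_cases hj : ∃ j', j = t j'
  · obtain ⟨j', rfl⟩ := hj
    by_cases hi : ∃ i', i = t i'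
    · obtain ⟨i', rfl⟩ := hi
      refine ⟨partialConj (fun j => A (t j)) i' j' w, induces_of_forall fun k a => ?_,
        Or.inr ⟨i', j', w, fun h => hij (h ▸ rfl), rfl⟩⟩
      by_cases hk : ∃ k', k = t k'
      · obtain ⟨k', rfl⟩ := hk
        rw [retract_of A ht]
        by_cases hki : k' = i'
        · subst hki
          rw [partialConj_of_self, partialConj_of_self]
          simp only [map_mul, map_inv, retract_of A ht]
        · rw [partialConj_of_ne _ hki, partialConj_of_ne A fun h => hki (ht h), retract_of A ht]
      · push Not at hk
        rw [partialConj_of_ne A (hk i'), retract_of_of_notMem A hk, map_one]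
    · push Not at hi
      refine ⟨1, induces_of_forall fun k a => ?_, Or.inl rfl⟩
      by_cases hki : k = i
      · subst hki
        rw [partialConj_of_self]
        simp [retract_of_of_notMem A hi]
      · rw [partialConj_of_ne A hki, MulAut.one_apply]
  · push Not at hj
    refine ⟨1, induces_of_forall fun k a => ?_, Or.inl rfl⟩
    by_cases hki : k = i
    · subst hki
      rw [partialConj_of_self]
      simp [retract_of_of_notMem A hj]
    · rw [partialConj_of_ne A hki, MulAut.one_apply]

end Retract

/-! ### Twists: commutation, and their images on three factors. -/

section Twist

variable {n : ℕ} (A : Fin n → Type*) [∀ i, Group (A i)]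

/-- The automorphism `∏_{k ≠ i, j} F_{A k}^{x_i} F_{A k}^{x_j}`. -/
def autTwist (i j : Fin n) (xi : A i) (xj : A j) : MulAut (CoprodI A) :=
  (((List.finRange n).filter fun k => k ≠ i ∧ k ≠ j).map fun k =>
    partialConj A k i xi * partialConj A k j xj).prod

theorem mk_autTwist (i j : Fin n) (xi : A i) (xj : A j) :
    (QuotientGroup.mk (autTwist A i j xi xj) : Out (CoprodI A)) = outTwist A i j xi xj := by
  rw [autTwist, outTwist]
  change QuotientGroup.mk' _ _ = _
  rw [map_list_prod, List.map_map]
  rfl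

variable {A} {i j : Fin n} (xi : A i) (xj : A j)

theorem prod_map_partialConj_of (L : List (Fin n)) (hL : L.Nodup)
    (h : ∀ k ∈ L, k ≠ i ∧ k ≠ j) (l : Fin n) (a : A l) :
    ((L.map fun k => partialConj A k i xi * partialConj A k j xj).prod) (of a) =
      if l ∈ L then of xj * of xi * of a * (of xj * of xi)⁻¹ else of a := by
  induction L with
  | nil => simp
  | cons k L ih =>
    obtain ⟨hk, hL'⟩ := List.nodup_cons.1 hL
    have hki := (h k (by simp)).1
    have hkj := (h k (by simp)).2
    rw [List.map_cons, List.prod_cons, MulAut.mul_apply,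
      ih hL' fun k' hk' => h k' (List.mem_cons_of_mem _ hk')]
    by_cases hl : l = k
    · subst hl
      rw [if_neg hk, if_pos (by simp), MulAut.mul_apply, partialConj_of_self, map_mul, map_mul,
        map_inv, partialConj_of_self, partialConj_of_ne A hkj.symm]
      group
    · have h2 : ∀ {p : Fin n}, p ≠ k → ∀ b : A p,
          (partialConj A k i xi * partialConj A k j xj) (of b) = of b := fun hp b => by
        rw [MulAut.mul_apply, partialConj_of_ne A hp, partialConj_of_ne A hp]
      by_cases hlL : l ∈ L
      · rw [if_pos hlL, if_pos (by simp [hlL])]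
        simp only [map_mul, map_inv, h2 hl, h2 hki.symm, h2 hkj.symm]
      · rw [if_neg hlL, if_neg (by simp [hl, hlL]), h2 hl]

theorem autTwist_of_ne {l : Fin n} (hi : l ≠ i) (hj : l ≠ j) (a : A l) :
    autTwist A i j xi xj (of a) = of xj * of xi * of a * (of xj * of xi)⁻¹ := by
  rw [autTwist, prod_map_partialConj_of _ _ _ ((List.nodup_finRange n).filter _)
    (fun k hk => by simpa using (List.mem_filter.1 hk).2)]
  simp [hi, hj]

theorem autTwist_of_left (a : A i) : autTwist A i j xi xj (of a) = of a := by
  rw [autTwist, prod_map_partialConj_of _ _ _ ((List.nodup_finRange n).filter _)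
    (fun k hk => by simpa using (List.mem_filter.1 hk).2)]
  simp

theorem autTwist_of_right (a : A j) : autTwist A i j xi xj (of a) = of a := by
  rw [autTwist, prod_map_partialConj_of _ _ _ ((List.nodup_finRange n).filter _)
    (fun k hk => by simpa using (List.mem_filter.1 hk).2)]
  simp

theorem commute_outTwist {k l : Fin n} (hik : i ≠ k) (hil : i ≠ l) (hjk : j ≠ k) (hjl : j ≠ l)
    (xk : A k) (xl : A l) : Commute (outTwist A i j xi xj) (outTwist A k l xk xl) := by
  rw [← mk_autTwist, ← mk_autTwist, Commute, SemiconjBy, ← QuotientGroup.mk_mul,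
    ← QuotientGroup.mk_mul]
  set u : CoprodI A := of xj * of xi with hu
  set v : CoprodI A := of xl * of xk with hv
  set T := autTwist A i j xi xj with hT
  set S := autTwist A k l xk xl with hS
  have hTv : T v = u * v * u⁻¹ := by
    rw [hv, map_mul, hT, autTwist_of_ne _ _ hik.symm hjk.symm,
      autTwist_of_ne _ _ hil.symm hjl.symm, ← hu]
    group
  have hSu : S u = v * u * v⁻¹ := by
    rw [hu, map_mul, hS, autTwist_of_ne _ _ hik hil, autTwist_of_ne _ _ hjk hjl, ← hv]
    group
  -- `T` conjugates `v` by `u`, and `S` conjugates `u` by `v`, so the two composites differ by the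
  -- commutator of `u` and `v` on every factor.
  have key : T * S = MulAut.conj (u * v * u⁻¹ * v⁻¹) * (S * T) := by
    refine mulAut_ext A fun p a => ?_
    rw [MulAut.mul_apply, MulAut.mul_apply, MulAut.mul_apply, MulAut.conj_apply]
    by_cases hpij : p = i ∨ p = j
    · have h1 : T (of a) = of a := by
        rcases hpij with rfl | rfl
        · exact autTwist_of_left _ _ _
        · exact autTwist_of_right _ _ _
      have h2 : S (of a) = v * of a * v⁻¹ := by
        rcases hpij with rfl | rfl
        · exact autTwist_of_ne _ _ hik hil _
        · exact autTwist_of_ne _ _ hjk hjl _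
      simp only [h1, h2, map_mul, map_inv, hTv]
      group
    push Not at hpij
    have h1 : T (of a) = u * of a * u⁻¹ := autTwist_of_ne _ _ hpij.1 hpij.2 _
    by_cases hpkl : p = k ∨ p = l
    · have h2 : S (of a) = of a := by
        rcases hpkl with rfl | rfl
        · exact autTwist_of_left _ _ _
        · exact autTwist_of_right _ _ _
      simp only [h1, h2, map_mul, map_inv, hSu]
      group
    push Not at hpkl
    have h2 : S (of a) = v * of a * v⁻¹ := autTwist_of_ne _ _ hpkl.1 hpkl.2 _
    simp only [h1, h2, map_mul, map_inv, hSu, hTv]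
    group
  rw [key, QuotientGroup.mk_mul,
    (QuotientGroup.eq_one_iff (MulAut.conj (u * v * u⁻¹ * v⁻¹))).2
      (MonoidHom.mem_range.2 ⟨_, rfl⟩), one_mul]

variable {t : Fin 3 → Fin n}

theorem induces_autTwist (ht : Function.Injective t) (x₀ : A (t 0)) (x₁ : A (t 1)) :
    Induces A t (autTwist A (t 0) (t 1) x₀ x₁)
      (partialConjAction (fun j => A (t j))
        (of (M := fun j => A (t j)) (i := 0) x₀⁻¹ * of (M := fun j => A (t j)) (i := 1) x₁⁻¹)) := by
  have hact : ∀ y, partialConjAction (fun j => A (t j))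
        (of (M := fun j => A (t j)) (i := 0) x₀⁻¹ * of (M := fun j => A (t j)) (i := 1) x₁⁻¹) y =
      partialConj (fun j => A (t j)) 2 0 x₀ (partialConj (fun j => A (t j)) 2 1 x₁ y) := by
    intro y
    rw [map_mul, partialConjAction_of, partialConjAction_of, inv_inv, inv_inv, MulAut.mul_apply]
    -- `otherIdx` sends both `0` and `1` to `2`, the factor that the twist conjugates.
    rfl
  refine induces_of_forall fun k a => ?_
  rw [hact]
  by_cases hk : ∃ k', k = t k'
  · obtain ⟨k', rfl⟩ := hk
    rw [retract_of A ht]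
    fin_cases k'
    · rw [autTwist_of_left, retract_of A ht, partialConj_of_ne _ (by decide),
        partialConj_of_ne _ (by decide)]
    · rw [autTwist_of_right, retract_of A ht, partialConj_of_ne _ (by decide),
        partialConj_of_ne _ (by decide)]
    · have h0 : t 2 ≠ t 0 := fun h => absurd (ht h) (by decide)
      have h1 : t 2 ≠ t 1 := fun h => absurd (ht h) (by decide)
      change retract A t (autTwist A (t 0) (t 1) x₀ x₁ (of (M := A) (i := t 2) a)) =
        partialConj (fun j => A (t j)) 2 0 x₀ (partialConj (fun j => A (t j)) 2 1 x₁
          (of (M := fun j => A (t j)) (i := 2) a))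
      rw [autTwist_of_ne _ _ h0 h1, partialConj_of_self, map_mul (partialConj _ _ _ _),
        map_mul (partialConj _ _ _ _), map_inv (partialConj _ _ _ _),
        partialConj_of_self, partialConj_of_ne _ (by decide)]
      simp only [map_mul, map_inv, retract_of A ht]
      group
  · push Not at hk
    rw [autTwist_of_ne _ _ (hk 0) (hk 1)]
    simp [retract_of_of_notMem A hk]

/-- With `A l` killed, the twist conjugates every factor but the third by `x₂`; correcting on that
factor makes it inner. Such a product contributes no length. -/
theorem induces_autTwist_of_notMem (ht : Function.Injective t) {l : Fin n} (hl : ∀ j, l ≠ t j)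
    (x₂ : A (t 2)) (y : A l) :
    Induces A t (autTwist A (t 2) l x₂ y)
      (MulAut.conj (of (M := fun j => A (t j)) (i := 2) x₂) *
        partialConj (fun j => A (t j)) 2 2 x₂⁻¹) := by
  refine induces_of_forall fun k a => ?_
  by_cases hk : ∃ k', k = t k'
  · obtain ⟨k', rfl⟩ := hk
    rw [retract_of A ht, MulAut.mul_apply, MulAut.conj_apply]
    by_cases hk2 : k' = 2
    · subst hk2
      rw [autTwist_of_left, partialConj_of_self, retract_of A ht]
      simp [mul_assoc]
    · rw [autTwist_of_ne _ _ (fun h => hk2 (ht h)) (hl k').symm, partialConj_of_ne _ hk2]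
      simp [retract_of_of_notMem A hl, retract_of A ht]
  · push Not at hk
    rw [retract_of_of_notMem A hk, map_one]
    by_cases hkl : k = l
    · subst hkl
      rw [autTwist_of_right, retract_of_of_notMem A hk]
    · rw [autTwist_of_ne _ _ (hk 2) hkl]
      simp [retract_of_of_notMem A hk]

/-- The outer automorphisms represented by an automorphism that induces one of length at most
`m`. -/
def InducesLength (A : Fin n → Type*) [∀ i, Group (A i)] (t : Fin 3 → Fin n) (m : ℕ)
    (γ : Out (CoprodI A)) : Prop :=
  ∃ (φ : MulAut (CoprodI A)) (θ : _), QuotientGroup.mk φ = γ ∧ Induces A t φ θ ∧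
    HasLength (fun j => A (t j)) m θ

theorem inducesLength_one : InducesLength A t 0 1 :=
  ⟨1, 1, rfl, induces_one, 1, 1, 1, one_mem _, by simp [len_one], by simp⟩

theorem InducesLength.mul_outPartialConj (ht : Function.Injective t) {m : ℕ}
    {γ : Out (CoprodI A)} (hγ : InducesLength A t m γ) {i j : Fin n} (hij : i ≠ j) (w : A j) :
    InducesLength A t (m + 1) (γ * outPartialConj A i j w) := by
  obtain ⟨φ, θ, rfl, hφ, hθ⟩ := hγ
  obtain ⟨η, hη, h⟩ := exists_induces_partialConj ht hij w
  refine ⟨φ * partialConj A i j w, θ * η, rfl, hφ.mul hη, ?_⟩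
  rcases h with rfl | ⟨i', j', w', hij', rfl⟩
  · rw [mul_one]
    exact hθ.mono _ (Nat.le_succ m)
  · exact hθ.mul_partialConj _ hij' w'

/-- Inner automorphisms are normal, so the products of this shape form a subgroup. -/
theorem exists_conj_mul_zpow {G : Type*} [Group G] {N : Subgroup (MulAut G)} {ν : MulAut G}
    (hν : ν ∈ N) (g : G) (b : ℤ) : ∃ g' : G, ∃ ν' ∈ N,
      (MulAut.conj g * ν) ^ b = MulAut.conj g' * ν' := by
  have h : (MulAut.conj g * ν) ^ b ∈ (MulAut.conj (G := G)).range ⊔ N :=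
    zpow_mem (mul_mem (Subgroup.mem_sup_left (MonoidHom.mem_range.2 ⟨g, rfl⟩))
      (Subgroup.mem_sup_right hν)) b
  obtain ⟨_, ⟨g', rfl⟩, ν', hν', e⟩ := Subgroup.mem_sup_of_normal_left.1 h
  exact ⟨g', ν', hν', e.symm⟩

/-- The second twist is absorbed into the inner and factorwise inner parts, leaving the action of a
power of a product of two letters, whose length is `2|a|`. -/
theorem two_mul_natAbs_le (ht : Function.Injective t) {l : Fin n} (hl : ∀ j, l ≠ t j)
    {x₀ : A (t 0)} {x₁ : A (t 1)} {x₂ : A (t 2)} (h₀ : x₀ ≠ 1) (h₁ : x₁ ≠ 1) (h₂ : x₂ ≠ 1)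
    (y : A l) (a b : ℤ) {m : ℕ}
    (h : InducesLength A t m
      (outTwist A (t 0) (t 1) x₀ x₁ ^ a * outTwist A (t 2) l x₂ y ^ b)) :
    2 * a.natAbs ≤ m := by
  obtain ⟨φ, θ, hφ, hi, hθ⟩ := h
  rw [← mk_autTwist, ← mk_autTwist, ← QuotientGroup.mk_zpow, ← QuotientGroup.mk_zpow,
    ← QuotientGroup.mk_mul, eq_comm, QuotientGroup.eq] at hφ
  obtain ⟨z, hz⟩ := hφ
  -- The given representative `φ` differs from the product of twists by an inner automorphism, which
  -- also induces an inner one.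
  rw [eq_inv_mul_iff_mul_eq, mul_conj] at hz
  obtain ⟨g', ν, hν, e⟩ := exists_conj_mul_zpow (N := factorInner (fun j => A (t j)))
    (ν := partialConj (fun j => A (t j)) 2 2 x₂⁻¹) (Subgroup.subset_closure ⟨2, _, rfl⟩)
    (of (M := fun j => A (t j)) (i := 2) x₂) b
  have hi' := (induces_conj (t := t)
    ((autTwist A (t 0) (t 1) x₀ x₁ ^ a * autTwist A (t 2) l x₂ y ^ b) z)).mul
    (((induces_autTwist ht x₀ x₁).zpow a).mul ((induces_autTwist_of_notMem ht hl x₂ y).zpow b))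
  rw [hz] at hi'
  rw [hi.unique ht hi', e, ← map_zpow] at hθ
  have hB : ∀ j, Nontrivial (A (t j)) := by
    intro j
    fin_cases j
    · exact ⟨x₀, 1, h₀⟩
    · exact ⟨x₁, 1, h₁⟩
    · exact ⟨x₂, 1, h₂⟩
  rw [← mul_assoc (partialConjAction _ _), mul_conj, ← mul_assoc, ← mul_assoc, ← map_mul] at hθ
  have := HasLength.len_le _ hB hν hθ
  rw [← inv_zpow, mul_inv_rev, ← map_inv, ← map_inv, inv_inv, inv_inv] at this
  exact (len_mul_zpow (M := fun j => A (t j)) (p := 1) (q := 0) (by decide) h₁ h₀ a).ge.trans this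

end Twist

end FreeProd

/-! ### Word metrics and a criterion for an undistorted `ℤ × ℤ`. -/

section WordMetric

open SimpleGraph

theorem dist_map_le_mul_dist {V W : Type*} {G : SimpleGraph V} {H : SimpleGraph W}
    (hG : G.Connected) (hH : H.Connected) {f : V → W} {K : ℕ}
    (hf : ∀ u v, G.Adj u v → H.dist (f u) (f v) ≤ K) (u v : V) :
    H.dist (f u) (f v) ≤ K * G.dist u v := by
  obtain ⟨p, hp⟩ := hG.exists_walk_length_eq_dist u v
  rw [← hp]
  clear hp
  induction p with
  | nil => simp
  | @cons u w v h p ih =>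
    rw [Walk.length_cons]
    calc H.dist (f u) (f v) ≤ H.dist (f u) (f w) + H.dist (f w) (f v) := hH.dist_triangle
      _ ≤ K + K * p.length := Nat.add_le_add (hf _ _ h) ih
      _ = K * (p.length + 1) := by ring

variable {G : Type*} [Group G] {S : Set G}

theorem mulCayley_connected (hS : Subgroup.closure S = ⊤) : (mulCayley S).Connected := by
  have hstep : ∀ x s : G, s ∈ S → (mulCayley S).Reachable x (x * s) := by
    intro x s hs
    by_cases h : x = x * s
    · rw [← h]
    · exact Adj.reachable ((mulCayley_adj' S _ _).2 ⟨h, s, hs, Or.inl rfl⟩)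
  have h1 : ∀ g : G, (mulCayley S).Reachable 1 g := by
    intro g
    have hg : g ∈ Subgroup.closure S := hS ▸ Subgroup.mem_top g
    induction hg using Subgroup.closure_induction_right with
    | one => rfl
    | mul_right x _ y hy ih => exact ih.trans (hstep x y hy)
    | mul_inv_cancel x _ y hy ih =>
      refine ih.trans ?_
      have := hstep (x * y⁻¹) y hy
      rw [inv_mul_cancel_right] at this
      exact this.symm
  exact ⟨fun u v => (h1 u).symm.trans (h1 v)⟩

theorem dist_mul_left_le (hS : Subgroup.closure S = ⊤) (g u v : G) :
    (mulCayley S).dist (g * u) (g * v) ≤ (mulCayley S).dist u v := by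
  have hc := mulCayley_connected hS
  have := dist_map_le_mul_dist hc hc (f := fun x => g * x) (K := 1)
    (fun u v h => (dist_eq_one_iff_adj.2 (mulCayley_adj_mul_iff_right.2 h)).le) u v
  simpa using this

theorem dist_eq_dist_one (hS : Subgroup.closure S = ⊤) (u v : G) :
    (mulCayley S).dist u v = (mulCayley S).dist 1 (u⁻¹ * v) := by
  apply le_antisymm
  · simpa using dist_mul_left_le hS u 1 (u⁻¹ * v)
  · simpa using dist_mul_left_le hS u⁻¹ u v

theorem dist_one_mul_le (hS : Subgroup.closure S = ⊤) (u v : G) :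
    (mulCayley S).dist 1 (u * v) ≤ (mulCayley S).dist 1 u + (mulCayley S).dist 1 v := by
  refine (mulCayley_connected hS).dist_triangle (v := u) |>.trans ?_
  rw [dist_eq_dist_one hS u]
  simp

theorem dist_one_inv (hS : Subgroup.closure S = ⊤) (u : G) :
    (mulCayley S).dist 1 u⁻¹ = (mulCayley S).dist 1 u := by
  rw [dist_comm, dist_eq_dist_one hS]
  simp

theorem dist_one_zpow_le (hS : Subgroup.closure S = ⊤) (u : G) (a : ℤ) :
    (mulCayley S).dist 1 (u ^ a) ≤ a.natAbs * (mulCayley S).dist 1 u := by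
  have hn : ∀ k : ℕ, (mulCayley S).dist 1 (u ^ k) ≤ k * (mulCayley S).dist 1 u := by
    intro k
    induction k with
    | zero => simp
    | succ k ih =>
      rw [pow_succ, add_mul, one_mul]
      exact (dist_one_mul_le hS _ _).trans (Nat.add_le_add_right ih _)
  obtain ⟨k, rfl | rfl⟩ := a.eq_nat_or_neg
  · simpa using hn k
  · simpa [dist_one_inv hS] using hn k

/-- Homomorphisms from finitely generated groups are Lipschitz for word metrics. -/
theorem exists_dist_map_le {H : Type*} [Group H] {T : Set H} (hS : Subgroup.closure S = ⊤)
    (hT : Subgroup.closure T = ⊤) (hfin : T.Finite) (f : H →* G) :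
    ∃ K : ℕ, ∀ u v, (mulCayley S).dist (f u) (f v) ≤ K * (mulCayley T).dist u v := by
  obtain ⟨K, hK⟩ := (hfin.image fun t => (mulCayley S).dist 1 (f t)).bddAbove
  have hK' : ∀ t ∈ T, (mulCayley S).dist 1 (f t) ≤ K := fun t ht => hK ⟨t, ht, rfl⟩
  refine ⟨K, dist_map_le_mul_dist (mulCayley_connected hT) (mulCayley_connected hS) ?_⟩
  rintro u v h
  obtain ⟨-, t, ht, rfl | rfl⟩ := (mulCayley_adj' T _ _).1 h
  · rw [dist_eq_dist_one hS]
    simpa using hK' t ht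
  · rw [dist_comm, dist_eq_dist_one hS]
    simpa using hK' t ht

/-- The homomorphism from `ℤ × ℤ` defined by two commuting elements. -/
def zpowPairHom {x y : G} (h : Commute x y) : Multiplicative (ℤ × ℤ) →* G where
  toFun p := x ^ p.toAdd.1 * y ^ p.toAdd.2
  map_one' := by simp
  map_mul' p q := by
    have := (h.zpow_zpow q.toAdd.1 p.toAdd.2).eq
    simp only [toAdd_mul, Prod.fst_add, Prod.snd_add, zpow_add]
    rw [mul_assoc, mul_assoc, ← mul_assoc (x ^ q.toAdd.1), this]
    simp only [mul_assoc]

theorem range_zpowPairHom {x y : G} (h : Commute x y) :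
    (zpowPairHom h).range = Subgroup.closure {x, y} := by
  apply le_antisymm
  · rintro _ ⟨p, rfl⟩
    exact mul_mem (zpow_mem (Subgroup.subset_closure (by simp)) _)
      (zpow_mem (Subgroup.subset_closure (by simp)) _)
  · rw [Subgroup.closure_le]
    rintro z (rfl | rfl)
    · exact ⟨Multiplicative.ofAdd (1, 0), by simp [zpowPairHom]⟩
    · exact ⟨Multiplicative.ofAdd (0, 1), by simp [zpowPairHom]⟩

/-- The lower bound at distance zero forces both exponents to vanish, so the map from `ℤ × ℤ` is
injective. -/
theorem nonempty_closure_pair_mulEquiv {x y : G} (hxy : Commute x y)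
    (hlow : ∀ a b : ℤ, a.natAbs + b.natAbs ≤ (mulCayley S).dist 1 (x ^ a * y ^ b)) :
    Nonempty (Subgroup.closure {x, y} ≃* Multiplicative (ℤ × ℤ)) := by
  have hinj : Function.Injective (zpowPairHom hxy) := by
    rw [injective_iff_map_eq_one]
    intro p hp
    have h := hlow p.toAdd.1 p.toAdd.2
    rw [show x ^ p.toAdd.1 * y ^ p.toAdd.2 = 1 from hp, SimpleGraph.dist_self] at h
    exact Multiplicative.toAdd.injective (Prod.ext (by simp; omega) (by simp; omega))
  exact ⟨((MonoidHom.ofInjective hinj).trans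
    (MulEquiv.subgroupCongr (range_zpowPairHom hxy))).symm⟩

/-- A lower bound for one finite generating set suffices, since any two finite generating sets of
`G` give bi-Lipschitz word metrics. -/
theorem isUndistorted_closure_pair {x y : G} (hxy : Commute x y)
    (hS : Subgroup.closure S = ⊤) (hfin : S.Finite)
    (hlow : ∀ a b : ℤ, a.natAbs + b.natAbs ≤ (mulCayley S).dist 1 (x ^ a * y ^ b)) :
    IsUndistorted (Subgroup.closure {x, y}) := by
  refine ⟨⟨⟨hfin.toFinset, by simpa using hS⟩⟩, (Group.fg_iff_subgroup_fg _).2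
    ((Subgroup.fg_iff _).2 ⟨{x, y}, rfl, by simp⟩), ?_⟩
  intro S' T hS'fin hTfin hS' hT
  obtain ⟨K₁, hK₁⟩ := exists_dist_map_le hS' hT hTfin (Subgroup.closure {x, y}).subtype
  obtain ⟨K₂, hK₂⟩ := exists_dist_map_le hS hS' hS'fin (MonoidHom.id G)
  set X : Subgroup.closure {x, y} := ⟨x, Subgroup.subset_closure (by simp)⟩
  set Y : Subgroup.closure {x, y} := ⟨y, Subgroup.subset_closure (by simp)⟩
  set c := (mulCayley T).dist 1 X + (mulCayley T).dist 1 Y with hc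
  have hlower : ∀ u v, (mulCayley T).dist u v ≤
      c * K₂ * (mulCayley S').dist (u : G) (v : G) := by
    intro u v
    obtain ⟨p, hp⟩ : ((u⁻¹ * v : Subgroup.closure {x, y}) : G) ∈ (zpowPairHom hxy).range := by
      rw [range_zpowPairHom]
      exact (u⁻¹ * v).2
    have hp' : u⁻¹ * v = X ^ p.toAdd.1 * Y ^ p.toAdd.2 := Subtype.ext hp.symm
    have h1 : (mulCayley T).dist u v ≤ c * (p.toAdd.1.natAbs + p.toAdd.2.natAbs) := by
      rw [dist_eq_dist_one hT, hp']
      refine (dist_one_mul_le hT _ _).trans ((Nat.add_le_add (dist_one_zpow_le hT _ _)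
        (dist_one_zpow_le hT _ _)).trans ?_)
      rw [hc]
      nlinarith [Nat.zero_le (p.toAdd.1.natAbs * (mulCayley T).dist 1 Y),
        Nat.zero_le (p.toAdd.2.natAbs * (mulCayley T).dist 1 X)]
    have h2 : p.toAdd.1.natAbs + p.toAdd.2.natAbs ≤ K₂ * (mulCayley S').dist (u : G) (v : G) := by
      refine (hlow _ _).trans ?_
      rw [show x ^ p.toAdd.1 * y ^ p.toAdd.2 = (u : G)⁻¹ * v from hp, ← dist_eq_dist_one hS]
      exact hK₂ u v
    rw [mul_assoc]
    exact h1.trans (Nat.mul_le_mul_left c h2)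
  -- `K₁` serves the upper bound and `c * K₂` the lower one; the summand `1` ensures that the
  -- constant is at least `1`.
  refine ⟨(1 + K₁ + c * K₂ : ℕ), 0, by
    exact_mod_cast (Nat.le_add_right _ _).trans (Nat.le_add_right _ _),
    le_rfl, fun u v => ⟨?_, ?_⟩⟩
  · rw [sub_zero, inv_mul_le_iff₀ (by positivity)]
    simp only [wordDist]
    norm_cast
    exact (hlower u v).trans (Nat.mul_le_mul_right _ (by omega))
  · rw [add_zero]
    simp only [wordDist]
    norm_cast
    exact (hK₁ u v).trans (Nat.mul_le_mul_right _ (by omega))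

end WordMetric

/-! ### Word length in `Γₙ'` bounds the induced length, and the conclusion. -/

namespace FreeProd

open Monoid Monoid.CoprodI SimpleGraph

variable {n : ℕ} (A : Fin n → Type*) [∀ i, Group (A i)]

/-- The generators `f_{A i}^w` of `Γₙ'`. -/
def gammaGenerators : Set (GammaPrime A) :=
  {γ | ∃ (i j : Fin n) (w : A j), j ≠ i ∧ (γ : Out (CoprodI A)) = outPartialConj A i j w}

theorem closure_gammaGenerators : Subgroup.closure (gammaGenerators A) = ⊤ :=
  Subgroup.closure_closure_coe_preimage

theorem finite_gammaGenerators [∀ i, Finite (A i)] : (gammaGenerators A).Finite := by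
  have h : {φ | ∃ (i j : Fin n) (w : A j), j ≠ i ∧ φ = outPartialConj A i j w}.Finite := by
    refine (Set.finite_range fun p : Fin n × (Σ j, A j) =>
      outPartialConj A p.1 p.2.1 p.2.2).subset ?_
    rintro _ ⟨i, j, w, -, rfl⟩
    exact ⟨(i, ⟨j, w⟩), rfl⟩
  exact h.preimage (f := ((↑) : GammaPrime A → Out (CoprodI A))) Subtype.val_injective.injOn

variable {A}

/-- Along a path in the Cayley graph every edge multiplies by one partial conjugation, its inverse
being again one, so it costs at most one letter. -/
theorem inducesLength_dist {t : Fin 3 → Fin n} (ht : Function.Injective t) (γ : GammaPrime A) :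
    InducesLength A t ((mulCayley (gammaGenerators A)).dist 1 γ) (γ : Out (CoprodI A)) := by
  obtain ⟨p, hp⟩ :=
    (mulCayley_connected (closure_gammaGenerators A)).exists_walk_length_eq_dist 1 γ
  rw [← hp]
  have key : ∀ (u v : GammaPrime A) (p : (mulCayley (gammaGenerators A)).Walk u v) (m : ℕ),
      InducesLength A t m (u : Out (CoprodI A)) →
        InducesLength A t (m + p.length) (v : Out (CoprodI A)) := by
    intro u v p
    induction p with
    | nil => exact fun m h => h
    | @cons u w v h p ih =>
      intro m hu
      rw [Walk.length_cons, add_comm p.length, ← add_assoc]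
      refine ih _ ?_
      obtain ⟨-, s, ⟨i, j, x, hij, hs⟩, rfl | rfl⟩ := (mulCayley_adj' _ _ _).1 h
      · rw [Subgroup.coe_mul, hs]
        exact hu.mul_outPartialConj ht hij.symm x
      · have := hu.mul_outPartialConj ht hij.symm x⁻¹
        rwa [Subgroup.coe_mul, hs, outPartialConj, outPartialConj, ← partialConj_inv,
          QuotientGroup.mk_inv, mul_inv_cancel_right] at this
  simpa using key 1 γ p 0 inducesLength_one

end FreeProd

theorem mainTheorem4 {n : ℕ} (A : Fin n → Type*) [∀ i, Group (A i)] [∀ i, Finite (A i)]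
    (i₁ i₂ i₃ i₄ : Fin n) (hdistinct : [i₁, i₂, i₃, i₄].Nodup)
    (x₁ : A i₁) (x₂ : A i₂) (x₃ : A i₃) (x₄ : A i₄)
    (hx₁ : x₁ ≠ 1) (hx₂ : x₂ ≠ 1) (hx₃ : x₃ ≠ 1) (hx₄ : x₄ ≠ 1) :
    Nonempty
      ((Subgroup.closure {FreeProd.twist A i₁ i₂ x₁ x₂, FreeProd.twist A i₃ i₄ x₃ x₄} :
        Subgroup (FreeProd.GammaPrime A)) ≃* Multiplicative (ℤ × ℤ)) ∧
    IsUndistorted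
      (Subgroup.closure {FreeProd.twist A i₁ i₂ x₁ x₂, FreeProd.twist A i₃ i₄ x₃ x₄} :
        Subgroup (FreeProd.GammaPrime A)) := by
  simp only [List.nodup_cons, List.mem_cons, List.not_mem_nil, or_false, not_or,
    not_false_eq_true, List.nodup_nil, and_true] at hdistinct
  obtain ⟨⟨h12, h13, h14⟩, ⟨h23, h24⟩, h34⟩ := hdistinct
  have hcomm : Commute (FreeProd.twist A i₁ i₂ x₁ x₂) (FreeProd.twist A i₃ i₄ x₃ x₄) :=
    Subtype.ext (FreeProd.commute_outTwist x₁ x₂ h13 h14 h23 h24 x₃ x₄).eq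
  have ht : Function.Injective ![i₁, i₂, i₃] := by
    intro p q
    fin_cases p <;> fin_cases q <;> simp_all [eq_comm]
  have ht' : Function.Injective ![i₃, i₄, i₁] := by
    intro p q
    fin_cases p <;> fin_cases q <;> simp_all [eq_comm]
  have hl : ∀ j, i₄ ≠ ![i₁, i₂, i₃] j := by
    intro j
    fin_cases j <;> simp_all [eq_comm]
  have hl' : ∀ j, i₂ ≠ ![i₃, i₄, i₁] j := by
    intro j
    fin_cases j <;> simp_all [eq_comm]
  have hlow : ∀ a b : ℤ, a.natAbs + b.natAbs ≤
      (SimpleGraph.mulCayley (FreeProd.gammaGenerators A)).dist 1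
        (FreeProd.twist A i₁ i₂ x₁ x₂ ^ a * FreeProd.twist A i₃ i₄ x₃ x₄ ^ b) := by
    intro a b
    -- The triple without `i₄` sees only the first twist and the triple without `i₂` only the
    -- second; adding `2|a| ≤ d` and `2|b| ≤ d` gives `|a| + |b| ≤ d`.
    have h1 := FreeProd.two_mul_natAbs_le ht hl (x₀ := x₁) (x₁ := x₂) (x₂ := x₃) hx₁ hx₂ hx₃ x₄ a b
      (FreeProd.inducesLength_dist ht
        (FreeProd.twist A i₁ i₂ x₁ x₂ ^ a * FreeProd.twist A i₃ i₄ x₃ x₄ ^ b))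
    have h2 := FreeProd.two_mul_natAbs_le ht' hl' (x₀ := x₃) (x₁ := x₄) (x₂ := x₁) hx₃ hx₄ hx₁ x₂
      b a (FreeProd.inducesLength_dist ht'
        (FreeProd.twist A i₃ i₄ x₃ x₄ ^ b * FreeProd.twist A i₁ i₂ x₁ x₂ ^ a))
    rw [(hcomm.symm.zpow_zpow b a).eq] at h2
    omega
  exact ⟨nonempty_closure_pair_mulEquiv hcomm hlow,
    isUndistorted_closure_pair hcomm (FreeProd.closure_gammaGenerators A)
      (FreeProd.finite_gammaGenerators A) hlow⟩
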